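/- A Polish group $G$ is called quasi-torsion if it is topologically isomorphic to a closed subgroup of a product $\prod_{n\in\mathbb N} G_n$ of countable discrete torsion groups $G_n$, endowed with the product topology, such that every coordinate projection $G\to G_n$ is surjective. Theorem. Let $G$ be an abelian, quasi-torsion Polish group. If $G$ is not locally compact, then there exist a closed subgroup $L\le G$ and countably infinite, discrete groups $K_n$, $n\in\mathbb N$, such that $$\prod_{n\in\mathbb N} K_n \le G/L,$$ that is, the product $\prod_{n} K_n$ with the product topology is topologically isomorphic to a closed subgroup of $G/L$ with the quotient topology. -/

import Mathlib

/-- A (Polish) group `G` is quasi-`𝒟`, for a class `𝒟` of groups, if it is topologically isomorphic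
to a closed subgroup of a product of a sequence of countable discrete groups from `𝒟`, endowed with
the product topology, all of whose coordinate projections are surjective. -/
def IsQuasi (𝒟 : (A : Type) → [AddGroup A] → Prop)
    (G : Type*) [AddGroup G] [TopologicalSpace G] : Prop :=
  ∃ (A : ℕ → Type) (_ : ∀ n, AddGroup (A n)) (_ : ∀ n, TopologicalSpace (A n))
    (φ : G →+ ∀ n, A n),
    (∀ n, Countable (A n)) ∧ (∀ n, DiscreteTopology (A n)) ∧ (∀ n, 𝒟 (A n)) ∧
    Topology.IsClosedEmbedding φ ∧ ∀ n, Function.Surjective (fun g => φ g n)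

/-- A group is quasi-torsion if it is a closed subdirect product of a sequence of countable,
discrete torsion groups. -/
def IsQuasiTorsion (G : Type*) [AddGroup G] [TopologicalSpace G] : Prop :=
  IsQuasi (fun A _ => IsAddTorsion A) G

/-!
A quasi-torsion group `G` has a decreasing basis `V n` of open subgroups with `G / V n` torsion, and
is complete. As `G` is not locally compact, one may assume `V n / V (n + 1)` infinite for all `n`.

It suffices to find a closed subgroup `H` and subgroups `Q n ≥ V (n + 1)` such that `H / (H ⊓ Q n)`
is infinite and covered by `H ⊓ V n`. Indeed `H → ∏ n, H / (H ⊓ Q n)` is then triangular, hence an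
open surjection by successive approximation, and with `L` its kernel the product is isomorphic to
the closed subgroup `H / L` of `G / L` (`IsCompleteFiltration.exists_prod_embedding_quotient`).

Passing to a subsequence, there are two cases.

* Every `V n / V (n + 1)` has an infinite divisible quotient `V n / R`. Divisible groups being
  injective, `V n / R` has a complement `Q n / R` in `G / R`, and `H = G` works.
* No `V n / V m` with `n < m` has an infinite divisible quotient. Then these torsion groups are
  residually finite, in the strong sense that every finite subgroup is disjoint from a subgroup of
  finite index (`IsAddTorsion.exists_disjoint_finiteIndex`). Consequently, given finitely many
  elements of `G`, there is a new element of `V n`, nontrivial modulo `V (n + 1)` and the given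
  elements, whose multiples are independent of them modulo any finite number of the `V m`. An
  enumeration in which each index `n` occurs infinitely often yields a sequence `g`; let `H` be the
  closed subgroup it generates, and `Q n` the subgroup generated by `V (n + 1)` and those `g j` that
  were chosen for an index other than `n`. The `g i` chosen for the index `n` lie in `V n`, generate
  `H` modulo `Q n`, and are distinct modulo `Q n` (`notMem_sup_closure_of_independent`).
-/

open Filter Topology

/-! ### Torsion abelian groups without infinite divisible quotients -/

/-- A torsion abelian group satisfies `|T / nT| ≤ |T[n]|` when `T[n]` is finite. Equality holds in
finite groups, and finitely many classes of `T / nT` come from a finite subgroup of `T`. -/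
lemma IsAddTorsion.finset_card_quotient_nsmul_le {T : Type*} [AddCommGroup T] (hT : IsAddTorsion T)
    (n : ℕ) [Finite (nsmulAddMonoidHom (α := T) n).ker]
    (s : Finset (T ⧸ (nsmulAddMonoidHom (α := T) n).range)) :
    s.card ≤ Nat.card (nsmulAddMonoidHom (α := T) n).ker := by
  classical
  let E : AddSubgroup T := AddSubgroup.closure ((s.image Quotient.out : Finset T) : Set T)
  have : AddGroup.FG E := AddGroup.closure_finset_fg _
  have : Finite E := AddCommGroup.finite_of_fg_isAddTorsion E (hT.addSubgroup E)
  let f : E →+ E := nsmulAddMonoidHom n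
  have h1 : f.range.index = Nat.card f.ker := by
    have ha := f.range.index_mul_card
    have hb := f.ker.index_mul_card
    rw [AddSubgroup.index_ker, ← ha, mul_comm] at hb
    exact (Nat.eq_of_mul_eq_mul_right Nat.card_pos hb).symm
  have h2 : Nat.card f.ker ≤ Nat.card (nsmulAddMonoidHom (α := T) n).ker := by
    have hmem (x : f.ker) : ((x : E) : T) ∈ (nsmulAddMonoidHom (α := T) n).ker := by
      have hx : n • (x : E) = 0 := x.2
      exact congrArg Subtype.val hx
    refine Nat.card_le_card_of_injective (fun x => ⟨_, hmem x⟩) fun x y hxy => ?_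
    have h := Subtype.ext_iff.1 hxy
    exact Subtype.ext (Subtype.ext h)
  have h3 : f.range ≤ ((nsmulAddMonoidHom (α := T) n).range).comap E.subtype := by
    rintro _ ⟨y, rfl⟩
    exact ⟨y, by simp [f]⟩
  let g : (E ⧸ f.range) →+ (T ⧸ (nsmulAddMonoidHom (α := T) n).range) :=
    QuotientAddGroup.map _ _ E.subtype h3
  have h4 : (s : Set _) ⊆ Set.range g := by
    intro x hx
    have hxE : Quotient.out x ∈ E :=
      AddSubgroup.subset_closure (Finset.mem_coe.2 (Finset.mem_image_of_mem _ hx))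
    refine ⟨QuotientAddGroup.mk ⟨_, hxE⟩, ?_⟩
    simp [g]
  have : Finite (E ⧸ f.range) := inferInstance
  calc s.card = (s : Set _).ncard := (Set.ncard_coe_finset s).symm
    _ ≤ (Set.range g).ncard := Set.ncard_le_ncard h4 (Set.finite_range g)
    _ ≤ Nat.card (E ⧸ f.range) := by
        rw [← Set.image_univ, ← Set.ncard_univ]; exact Set.ncard_image_le Set.finite_univ
    _ ≤ _ := by rw [← AddSubgroup.index]; exact h1.trans_le h2

lemma IsAddTorsion.finite_quotient_nsmul {T : Type*} [AddCommGroup T] (hT : IsAddTorsion T)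
    (n : ℕ) [Finite (nsmulAddMonoidHom (α := T) n).ker] :
    Finite (T ⧸ (nsmulAddMonoidHom (α := T) n).range) := by
  by_contra h
  rw [not_finite_iff_infinite] at h
  obtain ⟨s, hs⟩ := Infinite.exists_subset_card_eq
    (T ⧸ (nsmulAddMonoidHom (α := T) n).range) (Nat.card (nsmulAddMonoidHom (α := T) n).ker + 1)
  have := hT.finset_card_quotient_nsmul_le n s
  omega

lemma IsAddTorsion.nsmul_surjective {T : Type*} [AddCommGroup T] (hT : IsAddTorsion T) (n : ℕ)
    (hn : ∀ t : T, n • t = 0 → t = 0) (t : T) : ∃ u, n • u = t := by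
  have hbot : (nsmulAddMonoidHom (α := T) n).ker = ⊥ := by
    rw [eq_bot_iff]; exact fun x hx => hn x hx
  have : Finite (nsmulAddMonoidHom (α := T) n).ker := by rw [hbot]; infer_instance
  classical
  have h := hT.finset_card_quotient_nsmul_le n {(t : T ⧸ _), (0 : T ⧸ _)}
  rw [hbot] at h
  have h0 : (t : T ⧸ (nsmulAddMonoidHom (α := T) n).range) = 0 := by
    by_contra h0
    rw [Finset.card_pair h0] at h
    simp at h
  exact (QuotientAddGroup.eq_zero_iff t).1 h0

/-- If all elements of prime order of a torsion abelian group `T` lie in a finite subgroup, then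
`T` is divisible modulo a finite subgroup `E`: representatives of the finite groups `T / qT`, for
the finitely many primes `q` with `T / qT ≠ 0`, generate such an `E`. -/
lemma IsAddTorsion.exists_finite_divisible_quotient {T : Type*} [AddCommGroup T]
    (hT : IsAddTorsion T) (F : AddSubgroup T) [Finite F]
    (hF : ∀ q : ℕ, q.Prime → ∀ t : T, q • t = 0 → t ∈ F) :
    ∃ E : AddSubgroup T, Finite E ∧ ∀ n : ℕ, n ≠ 0 → ∀ t : T, ∃ u, t - n • u ∈ E := by
  classical
  have hfin (q : ℕ) (hq : q.Prime) : ∃ s : Finset T, ∀ t : T, ∃ r ∈ s, ∃ u, t - r = q • u := by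
    have : Finite (nsmulAddMonoidHom (α := T) q).ker :=
      Set.Finite.subset (s := (F : Set T)) (Set.toFinite _) (fun t ht => hF q hq t ht)
    have := hT.finite_quotient_nsmul q
    refine ⟨(Set.finite_range
      (Quotient.out : (T ⧸ (nsmulAddMonoidHom (α := T) q).range) → T)).toFinset, fun t => ?_⟩
    refine ⟨Quotient.out (t : T ⧸ (nsmulAddMonoidHom (α := T) q).range), by simp, ?_⟩
    have h : ((Quotient.out (t : T ⧸ (nsmulAddMonoidHom (α := T) q).range) : T) :
      T ⧸ (nsmulAddMonoidHom (α := T) q).range) = t := by simp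
    obtain ⟨u, hu⟩ := QuotientAddGroup.eq.1 h
    exact ⟨u, by simpa [sub_eq_neg_add] using hu.symm⟩
  choose! s hs using hfin
  let S : Finset T := (Nat.card F).primeFactors.biUnion s
  have : AddGroup.FG (AddSubgroup.closure (S : Set T)) := AddGroup.closure_finset_fg _
  refine ⟨AddSubgroup.closure (S : Set T),
    AddCommGroup.finite_of_fg_isAddTorsion _ (hT.addSubgroup _), ?_⟩
  intro n
  induction n using induction_on_primes with
  | zero => simp
  | one => exact fun _ t => ⟨t, by simp⟩
  | prime_mul q a hq ih =>
    intro hn t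
    have hprime : ∃ u, t - q • u ∈ AddSubgroup.closure (S : Set T) := by
      by_cases hqF : q ∣ Nat.card F
      · obtain ⟨r, hr, u, hu⟩ := hs q hq t
        refine ⟨u, ?_⟩
        rw [← hu, sub_sub_cancel]
        refine AddSubgroup.subset_closure ?_
        simp only [S, Finset.coe_biUnion, Set.mem_iUnion]
        exact ⟨q, by simpa using ⟨hq, hqF, Nat.card_pos.ne'⟩, hr⟩
      · obtain ⟨u, hu⟩ := hT.nsmul_surjective q (fun t ht => by
          have h1 : Nat.card F • (⟨t, hF q hq t ht⟩ : F) = 0 := card_nsmul_eq_zero'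
          have h2 : Nat.card F • t = 0 := congrArg Subtype.val h1
          rw [← addOrderOf_dvd_iff_nsmul_eq_zero] at ht h2
          rw [← AddMonoid.addOrderOf_eq_one_iff]
          exact Nat.eq_one_of_dvd_coprimes ((Nat.Prime.coprime_iff_not_dvd hq).2 hqF) ht h2) t
        exact ⟨u, by simp [hu]⟩
    obtain ⟨u, hu⟩ := hprime
    obtain ⟨v, hv⟩ := ih (by rintro rfl; simp at hn) u
    refine ⟨v, ?_⟩
    have : t - (q * a) • v = (t - q • u) + q • (u - a • v) := by
      rw [smul_sub, mul_smul]; abel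
    rw [this]
    exact add_mem hu (AddSubgroup.nsmul_mem _ hv q)

/-- Residual finiteness: if a torsion abelian group `A` has no infinite divisible quotient, then
every finite subgroup `F` is disjoint from a subgroup of finite index. A maximal subgroup `B`
disjoint from `F` works, since all elements of prime order of `A / B` come from `F`. -/
lemma IsAddTorsion.exists_disjoint_finiteIndex {A : Type*} [AddCommGroup A] (hA : IsAddTorsion A)
    (hdiv : ∀ R : AddSubgroup A,
      (∀ n : ℕ, n ≠ 0 → ∀ a, ∃ b, a - n • b ∈ R) → R.FiniteIndex)
    (F : AddSubgroup A) [Finite F] :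
    ∃ B : AddSubgroup A, (∀ x ∈ B, x ∈ F → x = 0) ∧ B.FiniteIndex := by
  obtain ⟨B, -, hB⟩ := zorn_le_nonempty₀ {B : AddSubgroup A | ∀ x ∈ B, x ∈ F → x = 0} (by
    intro c hc hchain y hy
    refine ⟨sSup c, ?_, fun z hz => le_sSup hz⟩
    intro x hx hxF
    obtain ⟨B, hBc, hxB⟩ := (AddSubgroup.mem_sSup_of_directedOn ⟨y, hy⟩ hchain.directedOn).1 hx
    exact hc hBc x hxB hxF) ⊥ (by simp)
  refine ⟨B, hB.prop, ?_⟩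
  have hTA : IsAddTorsion (A ⧸ B) := hA.of_surjective (QuotientAddGroup.mk'_surjective B)
  let F' : AddSubgroup (A ⧸ B) := F.map (QuotientAddGroup.mk' B)
  have : Finite F' := Set.Finite.image _ (Set.toFinite (F : Set A))
  obtain ⟨E, hE, hEdiv⟩ := hTA.exists_finite_divisible_quotient F' (by
    intro q hq t ht
    obtain ⟨t, rfl⟩ := QuotientAddGroup.mk_surjective t
    have hqt : q • t ∈ B := by
      rwa [← QuotientAddGroup.mk_nsmul, QuotientAddGroup.eq_zero_iff] at ht
    by_contra htF
    have hnot : ¬ ∀ x ∈ B ⊔ AddSubgroup.zmultiples t, x ∈ F → x = 0 := by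
      intro h
      have := hB.le_of_ge (y := B ⊔ AddSubgroup.zmultiples t) h le_sup_left
      have htB : t ∈ B := this (le_sup_right (a := B) (AddSubgroup.mem_zmultiples t))
      rw [(QuotientAddGroup.eq_zero_iff t).2 htB] at htF
      exact htF (zero_mem _)
    push Not at hnot
    obtain ⟨x, hx, hxF, hx0⟩ := hnot
    obtain ⟨b, hb, y, hy, rfl⟩ := AddSubgroup.mem_sup.1 hx
    obtain ⟨k, rfl⟩ := AddSubgroup.mem_zmultiples_iff.1 hy
    have hqk : ¬ (q : ℤ) ∣ k := by
      rintro ⟨l, rfl⟩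
      refine hx0 (hB.prop _ (add_mem hb ?_) hxF)
      rw [mul_comm, mul_smul]
      exact AddSubgroup.zsmul_mem _ (by simpa using hqt) l
    obtain ⟨u, v, huv⟩ := ((Nat.prime_iff_prime_int.1 hq).irreducible.coprime_iff_not_dvd).2 hqk
    refine htF ⟨v • (b + k • t), AddSubgroup.zsmul_mem _ hxF v, ?_⟩
    rw [QuotientAddGroup.mk'_apply, QuotientAddGroup.eq]
    have : -(v • (b + k • t)) + t = u • (q • t) - v • b := by
      nth_rw 2 [← one_smul ℤ t]
      rw [← huv, add_smul, smul_add, mul_smul, mul_smul, natCast_zsmul]; abel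
    rw [this]
    exact sub_mem (AddSubgroup.zsmul_mem _ hqt u) (AddSubgroup.zsmul_mem _ hb v))
  have hR := hdiv (E.comap (QuotientAddGroup.mk' B)) (by
    intro n hn a
    obtain ⟨u, hu⟩ := hEdiv n hn a
    obtain ⟨u, rfl⟩ := QuotientAddGroup.mk_surjective u
    exact ⟨u, hu⟩)
  have hEi : E.index ≠ 0 := by
    have := hR.index_ne_zero
    rwa [AddSubgroup.index_comap_of_surjective _ (QuotientAddGroup.mk'_surjective B)] at this
  have : Finite (A ⧸ B) := by
    refine Nat.finite_of_card_ne_zero ?_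
    rw [← E.index_mul_card]
    exact mul_ne_zero hEi Nat.card_pos.ne'
  exact AddSubgroup.finiteIndex_of_finite_quotient

/-- A divisible subgroup `(V + R) / R` of `G / R` is a direct summand, by injectivity of divisible
groups. -/
lemma AddSubgroup.exists_complement_of_divisible {G : Type*} [AddCommGroup G]
    (V R : AddSubgroup G)
    (hdiv : ∀ n : ℕ, n ≠ 0 → ∀ v ∈ V, ∃ u ∈ V, v - n • u ∈ R) :
    ∃ Q : AddSubgroup G, R ≤ Q ∧ Q ⊓ V ≤ R ∧ Q ⊔ V = ⊤ := by
  let D := V ⧸ R.addSubgroupOf V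
  have hsurj : ∀ {n : ℤ}, n ≠ 0 → Function.Surjective (fun a : D => n • a) := by
    intro n hn a
    obtain ⟨v, rfl⟩ := QuotientAddGroup.mk_surjective a
    obtain ⟨u, huV, hu⟩ := hdiv n.natAbs (by simpa using hn) v v.2
    have hmk : (v : D) = n.natAbs • ((⟨u, huV⟩ : V) : D) := by
      rw [← QuotientAddGroup.mk_nsmul, eq_comm, QuotientAddGroup.eq, AddSubgroup.mem_addSubgroupOf]
      simpa [sub_eq_neg_add] using hu
    rcases Int.natAbs_eq n with h | h
    · refine ⟨((⟨u, huV⟩ : V) : D), ?_⟩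
      dsimp only
      rw [h, natCast_zsmul, ← hmk]
    · refine ⟨-((⟨u, huV⟩ : V) : D), ?_⟩
      dsimp only
      rw [h, neg_smul, smul_neg, neg_neg, natCast_zsmul, ← hmk]
  let _ : DivisibleBy D ℤ := divisibleByOfSMulRightSurj D ℤ hsurj
  let j : D →+ G ⧸ R := QuotientAddGroup.map _ _ V.subtype le_rfl
  have hj : Function.Injective j := by
    rw [injective_iff_map_eq_zero]
    intro x hx
    obtain ⟨v, rfl⟩ := QuotientAddGroup.mk_surjective x
    rw [QuotientAddGroup.eq_zero_iff, AddSubgroup.mem_addSubgroupOf]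
    exact (QuotientAddGroup.eq_zero_iff _).1 hx
  obtain ⟨r, hr⟩ := Module.Baer.extension_property_addMonoidHom (Module.Baer.of_divisible D) j hj
    (AddMonoidHom.id D)
  have hrv (v : V) : r ((v : G) : G ⧸ R) = (v : D) := DFunLike.congr_fun hr (v : D)
  refine ⟨(r.comp (QuotientAddGroup.mk' R)).ker, ?_, ?_, ?_⟩
  · intro x hx
    simp [AddMonoidHom.mem_ker, (QuotientAddGroup.eq_zero_iff x).2 hx]
  · rintro x ⟨hx, hxV⟩
    have h1 : r (x : G ⧸ R) = 0 := hx
    rw [hrv ⟨x, hxV⟩] at h1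
    simpa [AddSubgroup.mem_addSubgroupOf] using (QuotientAddGroup.eq_zero_iff _).1 h1
  · rw [eq_top_iff]
    intro x _
    obtain ⟨v, hv⟩ := QuotientAddGroup.mk_surjective (r (x : G ⧸ R))
    rw [← sub_add_cancel x (v : G)]
    refine AddSubgroup.add_mem_sup ?_ v.2
    rw [AddMonoidHom.mem_ker]
    simp [hrv, hv]

/-! ### Quotients of closed subgroups onto products of discrete groups -/

/-- If `P` is a topological quotient of a closed subgroup `H` of `G`, then `P` embeds as a closed
subgroup in a quotient of `G`, namely in the quotient by the kernel of `H → P`. -/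
lemma exists_quotient_of_open_surjective {G P : Type*} [AddCommGroup G] [TopologicalSpace G]
    [IsTopologicalAddGroup G] [AddCommGroup P] [TopologicalSpace P] [T1Space P]
    (H : AddSubgroup G) (hH : IsClosed (H : Set G)) (f : H →+ P) (hc : Continuous f)
    (hs : Function.Surjective f) (ho : IsOpenMap f) :
    ∃ L : AddSubgroup G, IsClosed (L : Set G) ∧
      ∃ M : AddSubgroup (G ⧸ L), IsClosed (M : Set (G ⧸ L)) ∧ Nonempty (P ≃ₜ+ M) := by
  let L : AddSubgroup G := f.ker.map H.subtype
  have hLH : L ≤ H := AddSubgroup.map_subtype_le _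
  have hmemL (h : H) : (h : G) ∈ L ↔ f h = 0 := by
    rw [AddSubgroup.mem_map]
    exact ⟨fun ⟨x, hx, hxh⟩ => by rwa [← Subtype.ext hxh], fun hx => ⟨h, hx, rfl⟩⟩
  let M : AddSubgroup (G ⧸ L) := H.map (QuotientAddGroup.mk' L)
  have hmemM (g : G) : (g : G ⧸ L) ∈ M ↔ g ∈ H := by
    refine ⟨?_, fun hg => ⟨g, hg, rfl⟩⟩
    rintro ⟨h, hh, hhg⟩
    have := H.add_mem hh (hLH (QuotientAddGroup.eq.1 hhg))
    simpa using this
  refine ⟨L, ?_, M, ?_, ?_⟩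
  · have h1 : IsClosed (f.ker : Set H) := (isClosed_singleton (x := (0 : P))).preimage hc
    exact hH.isClosedEmbedding_subtypeVal.isClosedMap _ h1
  · rw [← (QuotientAddGroup.isQuotientMap_mk L).isClosed_preimage]
    convert hH using 1
    ext g
    exact hmemM g
  · let ψ : H →+ M := ((QuotientAddGroup.mk' L).comp H.subtype).codRestrict M
      fun h => (hmemM h).2 h.2
    have hψc : Continuous ψ :=
      (continuous_quotient_mk'.comp continuous_subtype_val).subtype_mk _
    have hψs : Function.Surjective ψ := by
      rintro ⟨m, hm⟩
      obtain ⟨h, hh, rfl⟩ := hm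
      exact ⟨⟨h, hh⟩, rfl⟩
    have hψo : IsOpenMap ψ := by
      rintro _ ⟨U, hU, rfl⟩
      refine ⟨_, QuotientAddGroup.isOpenMap_coe U hU, ?_⟩
      ext ⟨m, hm⟩
      constructor
      · rintro ⟨u, hu, rfl⟩
        exact ⟨⟨u, (hmemM u).1 hm⟩, hu, rfl⟩
      · rintro ⟨h, hh, hhm⟩
        exact ⟨h, hh, congrArg Subtype.val hhm⟩
    have hker : f.ker = ψ.ker := by
      ext h
      rw [AddMonoidHom.mem_ker, AddMonoidHom.mem_ker, ← hmemL h, Subtype.ext_iff]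
      exact (QuotientAddGroup.eq_zero_iff (h : G)).symm
    let e : P ≃+ M := (QuotientAddGroup.quotientKerEquivOfSurjective f hs).symm.trans
      ((QuotientAddGroup.quotientAddEquivOfEq hker).trans
        (QuotientAddGroup.quotientKerEquivOfSurjective ψ hψs))
    have he (h : H) : e (f h) = ψ h := by
      have : (QuotientAddGroup.quotientKerEquivOfSurjective f hs).symm (f h) = (h : H ⧸ f.ker) := by
        rw [AddEquiv.symm_apply_eq]; rfl
      simp only [e, AddEquiv.trans_apply, this]
      rfl
    have hqf : IsQuotientMap f := ho.isQuotientMap hc hs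
    have hqψ : IsQuotientMap ψ := hψo.isQuotientMap hψc hψs
    refine ⟨{ e with continuous_toFun := ?_, continuous_invFun := ?_ }⟩
    · refine hqf.continuous_iff.2 ?_
      convert hψc using 1
      exact funext he
    · refine hqψ.continuous_iff.2 ?_
      convert hc using 1
      exact funext fun h => e.symm_apply_eq.2 (he h).symm

/-- The product of a sequence of countably infinite discrete abelian groups is topologically
isomorphic to a closed subgroup of the quotient of `G` by a closed subgroup. -/
def HasInfiniteProductInQuotient (G : Type*) [AddCommGroup G] [TopologicalSpace G] : Prop :=
  ∃ L : AddSubgroup G, IsClosed (L : Set G) ∧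
    ∃ (K : ℕ → Type) (_ : ∀ n, AddCommGroup (K n)) (_ : ∀ n, TopologicalSpace (K n)),
      (∀ n, Infinite (K n)) ∧ (∀ n, Countable (K n)) ∧ (∀ n, DiscreteTopology (K n)) ∧
      ∃ M : AddSubgroup (G ⧸ L), IsClosed (M : Set (G ⧸ L)) ∧
        Nonempty ((∀ n, K n) ≃ₜ+ M)

/-- `V` is a decreasing sequence of open subgroups forming a neighbourhood basis of `0`, and `G` is
complete with respect to it: every sequence whose successive differences tend to `0` converges. -/
structure IsCompleteFiltration {G : Type*} [AddCommGroup G] [TopologicalSpace G]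
    (V : ℕ → AddSubgroup G) : Prop where
  antitone : Antitone V
  isOpen : ∀ n, IsOpen (V n : Set G)
  basis : ∀ U ∈ 𝓝 (0 : G), ∃ n, (V n : Set G) ⊆ U
  complete : ∀ s : ℕ → G, Tendsto (fun m => s (m + 1) - s m) atTop (𝓝 0) →
    ∃ g, Tendsto s atTop (𝓝 g)

namespace IsCompleteFiltration

variable {G : Type*} [AddCommGroup G] [TopologicalSpace G] {V : ℕ → AddSubgroup G}

lemma comp_strictMono (hV : IsCompleteFiltration V) {k : ℕ → ℕ} (hk : StrictMono k) :
    IsCompleteFiltration (fun n => V (k n)) where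
  antitone := hV.antitone.comp_monotone hk.monotone
  isOpen n := hV.isOpen _
  basis U hU := by
    obtain ⟨n, hn⟩ := hV.basis U hU
    exact ⟨n, subset_trans (hV.antitone hk.le_apply) hn⟩
  complete := hV.complete

variable [IsTopologicalAddGroup G]

lemma isClosed (hV : IsCompleteFiltration V) (n : ℕ) : IsClosed (V n : Set G) :=
  (V n).isClosed_of_isOpen (hV.isOpen n)

lemma exists_limit (hV : IsCompleteFiltration V) (s : ℕ → G)
    (hs : ∀ m, s (m + 1) - s m ∈ V m) :
    ∃ g, Tendsto s atTop (𝓝 g) ∧ ∀ m, g - s m ∈ V m := by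
  obtain ⟨g, hg⟩ := hV.complete s (by
    intro U hU
    obtain ⟨n, hn⟩ := hV.basis U hU
    rw [mem_map]
    filter_upwards [eventually_ge_atTop n] with m hm
    exact hn (hV.antitone hm (hs m)))
  refine ⟨g, hg, fun m => ?_⟩
  have hk (k : ℕ) (hk : m ≤ k) : s k - s m ∈ V m := by
    induction k, hk using Nat.le_induction with
    | base => simp
    | succ k hk ih =>
      have := add_mem (hV.antitone hk (hs k)) ih
      simpa using this
  exact (hV.isClosed m).mem_of_tendsto (hg.sub_const (s m))
    ((eventually_ge_atTop m).mono hk)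

/-- Simultaneous congruences modulo a triangular system of subgroups `Q m` can be solved in `H`,
by successive approximation: a correction in `H ⊓ V m` repairs the congruence modulo `Q m` without
changing those modulo `Q i` for `i < m`. If the first `k` congruences are trivial, the solution can
be taken in `V k`, which yields openness of `H → ∏ m, H / (H ⊓ Q m)`. -/
lemma exists_forall_sub_mem (hV : IsCompleteFiltration V) (H : AddSubgroup G)
    (hH : IsClosed (H : Set G)) (Q : ℕ → AddSubgroup G) (hVQ : ∀ m, V (m + 1) ≤ Q m)
    (hHQ : ∀ m, ∀ h ∈ H, ∃ v ∈ H ⊓ V m, h - v ∈ Q m)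
    (y : ℕ → G) (hy : ∀ m, y m ∈ H) (k : ℕ) (hyk : ∀ m < k, y m = 0) :
    ∃ h ∈ H ⊓ V k, ∀ m, h - y m ∈ Q m := by
  have hc (m : ℕ) (h : G) : ∃ v, (h ∈ H → v ∈ H ⊓ V m ∧ h - v ∈ Q m) ∧ (h = 0 → v = 0) := by
    by_cases h0 : h = 0
    · exact ⟨0, fun _ => by simp [h0, zero_mem], fun _ => rfl⟩
    · by_cases hh : h ∈ H
      · obtain ⟨v, hv⟩ := hHQ m h hh
        exact ⟨v, fun _ => hv, fun h1 => (h0 h1).elim⟩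
      · exact ⟨0, fun h1 => (hh h1).elim, fun _ => rfl⟩
  choose c hc hc0 using hc
  let s : ℕ → G := fun m => Nat.rec 0 (fun m x => x + c m (y m - x)) m
  have hs (m : ℕ) : s (m + 1) = s m + c m (y m - s m) := rfl
  have hsH (m : ℕ) : s m ∈ H := by
    induction m with
    | zero => exact zero_mem H
    | succ m ih =>
      rw [hs]
      exact add_mem ih (hc m _ (sub_mem (hy m) ih)).1.1
  have hs0 (m : ℕ) (hm : m ≤ k) : s m = 0 := by
    induction m with
    | zero => rfl
    | succ m ih =>
      rw [hs, ih (by omega), hc0 m _ (by simp [hyk m (by omega)]), add_zero]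
  obtain ⟨g, hg, hgs⟩ := hV.exists_limit s (fun m => by
    rw [hs, add_sub_cancel_left]
    exact (hc m _ (sub_mem (hy m) (hsH m))).1.2)
  refine ⟨g, ⟨hH.mem_of_tendsto hg (Eventually.of_forall hsH), ?_⟩, fun m => ?_⟩
  · simpa [hs0 k le_rfl] using hgs k
  · have h1 := hVQ m (hgs (m + 1))
    have h2 := (hc m _ (sub_mem (hy m) (hsH m))).2
    have : g - y m = (g - s (m + 1)) - (y m - s m - c m (y m - s m)) := by rw [hs]; abel
    rw [this]
    exact sub_mem h1 h2

/-- The quotients of `H` by the subgroups `Q m` of a triangular system give an open surjection from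
`H` onto their product. -/
lemma exists_prod_embedding_quotient [SecondCountableTopology G] (hV : IsCompleteFiltration V)
    (H : AddSubgroup G)
    (hH : IsClosed (H : Set G)) (Q : ℕ → AddSubgroup G) (hVQ : ∀ m, V (m + 1) ≤ Q m)
    (hHQ : ∀ m, ∀ h ∈ H, ∃ v ∈ H ⊓ V m, h - v ∈ Q m) (hinf : ∀ m, (Q m).relIndex H = 0) :
    HasInfiniteProductInQuotient G := by
  have hopen (m : ℕ) : IsOpen (((Q m).addSubgroupOf H : AddSubgroup H) : Set H) :=
    (AddSubgroup.isOpen_mono (hVQ m) (hV.isOpen _)).preimage continuous_subtype_val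
  have hdisc (m : ℕ) : DiscreteTopology (H ⧸ (Q m).addSubgroupOf H) :=
    QuotientAddGroup.discreteTopology (hopen m)
  have : SecondCountableTopology H :=
    TopologicalSpace.Subtype.secondCountableTopology (H : Set G)
  have hcount (m : ℕ) : Countable (H ⧸ (Q m).addSubgroupOf H) :=
    TopologicalSpace.separableSpace_iff_countable.1
      (QuotientAddGroup.mk_surjective.denseRange.separableSpace continuous_quotient_mk')
  have hinf' (m : ℕ) : Infinite (H ⧸ (Q m).addSubgroupOf H) :=
    (Nat.card_eq_zero.1 (hinf m)).resolve_left (fun h => h.false 0)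
  -- `H` lives in an arbitrary universe, so its countable quotients are moved to `Type`.
  have hK (m : ℕ) : ∃ (K : Type) (_ : AddCommGroup K),
      Nonempty ((H ⧸ (Q m).addSubgroupOf H) ≃+ K) :=
    ⟨Shrink.{0} (H ⧸ (Q m).addSubgroupOf H), inferInstance, ⟨Shrink.addEquiv.symm⟩⟩
  choose K _ he using hK
  let _ (m : ℕ) : TopologicalSpace (K m) := ⊥
  have hKd (m : ℕ) : DiscreteTopology (K m) := ⟨rfl⟩
  let e (m : ℕ) : (H ⧸ (Q m).addSubgroupOf H) ≃+ K m := (he m).some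
  let f : H →+ ∀ m, K m :=
    AddMonoidHom.pi fun m => (e m).toAddMonoidHom.comp (QuotientAddGroup.mk' _)
  have hf (h : H) (m : ℕ) : f h m = e m (h : H ⧸ _) := rfl
  have hfc : Continuous f := continuous_pi fun m =>
    (continuous_of_discreteTopology (f := e m)).comp continuous_quotient_mk'
  have hkey (k : ℕ) (z : ∀ m, K m) (hz : ∀ m < k, z m = 0) :
      ∃ h : H, (h : G) ∈ V k ∧ f h = z := by
    have hy (m : ℕ) : ∃ y : H, f y m = z m ∧ (m < k → y = 0) := by
      by_cases hm : m < k
      · exact ⟨0, by simp [hz m hm], fun _ => rfl⟩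
      · obtain ⟨y, hy⟩ := QuotientAddGroup.mk_surjective ((e m).symm (z m))
        exact ⟨y, by simp [hf, hy], fun h => (hm h).elim⟩
    choose y hy hy0 using hy
    obtain ⟨h, ⟨hhH, hhV⟩, hh⟩ := hV.exists_forall_sub_mem H hH Q hVQ hHQ (fun m => (y m : G))
      (fun m => (y m).2) k (fun m hm => by simp [hy0 m hm])
    refine ⟨⟨h, hhH⟩, hhV, funext fun m => ?_⟩
    rw [← hy m, hf, hf]
    congr 1
    rw [eq_comm, QuotientAddGroup.eq, AddSubgroup.mem_addSubgroupOf]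
    simpa [sub_eq_neg_add] using hh m
  have hfs : Function.Surjective f := fun z =>
    (hkey 0 z (by simp)).imp fun h hh => hh.2
  have hfo : IsOpenMap f := by
    rw [IsTopologicalAddGroup.isOpenMap_iff_nhds_zero]
    intro S hS
    rw [mem_map, nhds_subtype_eq_comap, mem_comap] at hS
    obtain ⟨U, hU, hUS⟩ := hS
    obtain ⟨k, hk⟩ := hV.basis U hU
    have : Set.pi (Set.Iio k) (fun m => ({0} : Set (K m))) ∈ 𝓝 (0 : ∀ m, K m) :=
      set_pi_mem_nhds (Set.finite_Iio k) fun m _ => by simp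
    filter_upwards [this] with z hz
    obtain ⟨h, hhV, rfl⟩ := hkey k z (fun m hm => hz m hm)
    exact hUS (hk hhV)
  obtain ⟨L, hL, M, hM, hLM⟩ := exists_quotient_of_open_surjective H hH f hfc hfs hfo
  exact ⟨L, hL, K, inferInstance, inferInstance, fun m => (e m).toEquiv.infinite_iff.1 (hinf' m),
    fun m => (e m).symm.injective.countable, hKd, M, hM, hLM⟩

end IsCompleteFiltration

/-! ### Subgroups with a divisible quotient, and independent elements -/

/-- `V / W` has an infinite divisible quotient `V / (R ⊓ V)` with `W ≤ R`. The subgroup `R` need not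
lie in `V`, and `R.relIndex V = 0` says that `R ⊓ V` has infinite index in `V`. -/
def HasInfiniteDivisibleQuotient {G : Type*} [AddCommGroup G] (V W : AddSubgroup G) : Prop :=
  ∃ R : AddSubgroup G, W ≤ R ∧ (∀ n : ℕ, n ≠ 0 → ∀ v ∈ V, ∃ u ∈ V, v - n • u ∈ R) ∧
    R.relIndex V = 0

section Independence

variable {G : Type*} [AddCommGroup G]

lemma HasInfiniteDivisibleQuotient.mono {V W W' : AddSubgroup G}
    (h : HasInfiniteDivisibleQuotient V W) (hW : W' ≤ W) : HasInfiniteDivisibleQuotient V W' :=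
  let ⟨R, hR⟩ := h
  ⟨R, hW.trans hR.1, hR.2⟩

lemma AddSubgroup.finite_map_mk_of_fg (W F : AddSubgroup G) (hF : F.FG)
    (htor : ∀ g : G, ∃ k : ℕ, k ≠ 0 ∧ k • g ∈ W) :
    Finite (F.map (QuotientAddGroup.mk' W)) := by
  have hT : IsAddTorsion (G ⧸ W) := by
    intro t
    obtain ⟨g, rfl⟩ := QuotientAddGroup.mk_surjective t
    obtain ⟨k, hk, hkg⟩ := htor g
    refine isOfFinAddOrder_iff_nsmul_eq_zero.2 ⟨k, Nat.pos_of_ne_zero hk, ?_⟩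
    rwa [← QuotientAddGroup.mk_nsmul, QuotientAddGroup.eq_zero_iff]
  classical
  obtain ⟨s, rfl⟩ := hF
  have : AddGroup.FG ((AddSubgroup.closure (s : Set G)).map (QuotientAddGroup.mk' W)) := by
    rw [AddMonoidHom.map_closure, ← Finset.coe_image]
    exact AddGroup.closure_finset_fg _
  exact AddCommGroup.finite_of_fg_isAddTorsion _ (hT.addSubgroup _)

lemma AddSubgroup.relIndex_map_subtype_comap_mk (V W : AddSubgroup G)
    (S : AddSubgroup (V ⧸ W.addSubgroupOf V)) :
    ((S.comap (QuotientAddGroup.mk' _)).map V.subtype).relIndex V = S.index := by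
  rw [AddSubgroup.relIndex, AddSubgroup.addSubgroupOf,
    AddSubgroup.comap_map_eq_self_of_injective V.subtype_injective,
    AddSubgroup.index_comap_of_surjective _ (QuotientAddGroup.mk'_surjective _)]

/-- The residual finiteness of torsion groups without infinite divisible quotients, for `V / W`. -/
lemma AddSubgroup.exists_relIndex_ne_zero_of_fg (V W F : AddSubgroup G) (hWV : W ≤ V) (hF : F.FG)
    (htor : ∀ g : G, ∃ k : ℕ, k ≠ 0 ∧ k • g ∈ W) (hVW : ¬ HasInfiniteDivisibleQuotient V W) :
    ∃ B : AddSubgroup G, B.relIndex V ≠ 0 ∧ ∀ x ∈ B, x ∈ F ⊔ W → x ∈ W := by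
  let A := V ⧸ W.addSubgroupOf V
  have hA : IsAddTorsion A := by
    intro t
    obtain ⟨g, rfl⟩ := QuotientAddGroup.mk_surjective t
    obtain ⟨k, hk, hkg⟩ := htor g
    refine isOfFinAddOrder_iff_nsmul_eq_zero.2 ⟨k, Nat.pos_of_ne_zero hk, ?_⟩
    rw [← QuotientAddGroup.mk_nsmul, QuotientAddGroup.eq_zero_iff, AddSubgroup.mem_addSubgroupOf]
    exact hkg
  let j : A →+ G ⧸ W := QuotientAddGroup.map _ _ V.subtype le_rfl
  have hj : Function.Injective j := by
    rw [injective_iff_map_eq_zero]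
    intro x hx
    obtain ⟨v, rfl⟩ := QuotientAddGroup.mk_surjective x
    rw [QuotientAddGroup.eq_zero_iff, AddSubgroup.mem_addSubgroupOf]
    exact (QuotientAddGroup.eq_zero_iff _).1 hx
  let F' : AddSubgroup A := (F.map (QuotientAddGroup.mk' W)).comap j
  have hFfin := AddSubgroup.finite_map_mk_of_fg W F hF htor
  have : Finite F' :=
    Set.Finite.preimage (f := j) hj.injOn
      (Set.toFinite (F.map (QuotientAddGroup.mk' W) : Set (G ⧸ W)))
  obtain ⟨B, hBF, hB⟩ := hA.exists_disjoint_finiteIndex (by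
    intro R hR
    by_contra hRi
    refine hVW ⟨(R.comap (QuotientAddGroup.mk' _)).map V.subtype, ?_, ?_, ?_⟩
    · intro w hw
      refine ⟨⟨w, hWV hw⟩, ?_, rfl⟩
      have : (QuotientAddGroup.mk' (W.addSubgroupOf V)) ⟨w, hWV hw⟩ = 0 := by
        rw [QuotientAddGroup.mk'_apply, QuotientAddGroup.eq_zero_iff]
        exact hw
      rw [SetLike.mem_coe, AddSubgroup.mem_comap, this]
      exact zero_mem R
    · intro n hn v hv
      obtain ⟨u, hu⟩ := hR n hn ((⟨v, hv⟩ : V) : A)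
      obtain ⟨u, rfl⟩ := QuotientAddGroup.mk_surjective u
      exact ⟨u, u.2, ⟨⟨v, hv⟩ - n • u, hu, rfl⟩⟩
    · rw [AddSubgroup.relIndex_map_subtype_comap_mk]
      by_contra h
      exact hRi ⟨h⟩) F'
  refine ⟨(B.comap (QuotientAddGroup.mk' _)).map V.subtype, ?_, ?_⟩
  · rw [AddSubgroup.relIndex_map_subtype_comap_mk]
    exact hB.index_ne_zero
  · rintro _ ⟨x, hxB, rfl⟩ hx
    have h0 := hBF _ hxB (by
      obtain ⟨y, hy, w, hw, hyw⟩ := AddSubgroup.mem_sup.1 hx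
      refine ⟨y, hy, ?_⟩
      change (y : G ⧸ W) = ((x : G) : G ⧸ W)
      rw [QuotientAddGroup.eq]
      have : (x : G) = y + w := hyw.symm
      simpa [this] using hw)
    rw [QuotientAddGroup.mk'_apply, QuotientAddGroup.eq_zero_iff] at h0
    exact h0

/-- A new element of `V n`, nontrivial modulo `F + V (n + 1)`, whose multiples are independent of
`F` modulo each of `V 1, …, V (N + 1)`. -/
lemma exists_independent_element {V : ℕ → AddSubgroup G} (hV : Antitone V)
    (htor : ∀ n, ∀ g : G, ∃ k : ℕ, k ≠ 0 ∧ k • g ∈ V n)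
    (n N : ℕ) (hinf : (V (n + 1)).relIndex (V n) = 0)
    (hdiv : ∀ m, n < m → ¬ HasInfiniteDivisibleQuotient (V n) (V m))
    (F : AddSubgroup G) (hF : F.FG) :
    ∃ x ∈ V n, x ∉ F ⊔ V (n + 1) ∧
      ∀ m ≤ N, ∀ k : ℤ, k • x ∈ F ⊔ V (m + 1) → k • x ∈ V (m + 1) := by
  have hB (m : ℕ) : ∃ B : AddSubgroup G, B.relIndex (V n) ≠ 0 ∧
      (n ≤ m → ∀ x ∈ B, x ∈ F ⊔ V (m + 1) → x ∈ V (m + 1)) := by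
    by_cases hm : n ≤ m
    · obtain ⟨B, h1, h2⟩ := AddSubgroup.exists_relIndex_ne_zero_of_fg (V n) (V (m + 1)) F
        (hV (by omega)) hF (htor _) (hdiv _ (by omega))
      exact ⟨B, h1, fun _ => h2⟩
    · exact ⟨⊤, by simp, fun h => (hm h).elim⟩
  choose B hBi hB using hB
  have hBi' : (⨅ m : Fin (N + 1), B m).relIndex (V n) ≠ 0 :=
    AddSubgroup.relIndex_iInf_ne_zero fun m => hBi m
  have hFi : (F ⊔ V (n + 1)).relIndex (V n) = 0 := by
    by_contra h
    refine AddSubgroup.relIndex_ne_zero_trans ?_ h hinf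
    rw [AddSubgroup.relIndex_sup_right]
    have := AddSubgroup.finite_map_mk_of_fg (V (n + 1)) F hF (htor _)
    nth_rw 1 [← QuotientAddGroup.ker_mk' (V (n + 1))]
    rw [AddSubgroup.relIndex_ker]
    exact Nat.card_pos.ne'
  have hx : ∃ x ∈ (⨅ m : Fin (N + 1), B m) ⊓ V n, x ∉ F ⊔ V (n + 1) := by
    by_contra! h
    refine hBi' ?_
    rw [← AddSubgroup.inf_relIndex_right]
    exact AddSubgroup.relIndex_eq_zero_of_le_left h hFi
  obtain ⟨x, ⟨hxB, hxV⟩, hx⟩ := hx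
  refine ⟨x, hxV, hx, fun m hm k hk => ?_⟩
  by_cases hnm : n ≤ m
  · have hxm : x ∈ B m := AddSubgroup.mem_iInf.1 hxB ⟨m, by omega⟩
    exact hB m hnm _ (AddSubgroup.zsmul_mem _ hxm k) hk
  · exact AddSubgroup.zsmul_mem _ (hV (by omega) hxV) k

/-- Iterating the choice of independent elements, with `l i` the index of the subgroup from which
the `i`-th element is chosen. -/
lemma exists_independent_sequence {V : ℕ → AddSubgroup G} (hV : Antitone V)
    (htor : ∀ n, ∀ g : G, ∃ k : ℕ, k ≠ 0 ∧ k • g ∈ V n)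
    (hinf : ∀ n, (V (n + 1)).relIndex (V n) = 0)
    (hdiv : ∀ n m, n < m → ¬ HasInfiniteDivisibleQuotient (V n) (V m)) (l : ℕ → ℕ) :
    ∃ (g : ℕ → G) (F : ℕ → AddSubgroup G), Monotone F ∧ (∀ i, g i ∈ F (i + 1)) ∧
      (∀ i, g i ∈ V (l i)) ∧ (∀ i, g i ∉ F i ⊔ V (l i + 1)) ∧
      ∀ i, ∀ m ≤ i, ∀ k : ℤ, k • g i ∈ F i ⊔ V (m + 1) → k • g i ∈ V (m + 1) := by
  choose x hxV hxF hx using fun (i : ℕ) (F : {F : AddSubgroup G // F.FG}) =>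
    exists_independent_element hV htor (l i) i (hinf _) (hdiv _) F.1 F.2
  let F : ℕ → {F : AddSubgroup G // F.FG} := fun i =>
    Nat.rec ⟨⊥, AddSubgroup.FG.bot⟩ (fun i F => ⟨F.1 ⊔ AddSubgroup.zmultiples (x i F),
      F.2.sup ⟨{x i F}, by simp [AddSubgroup.zmultiples_eq_closure]⟩⟩) i
  have hF (i : ℕ) : (F (i + 1)).1 = (F i).1 ⊔ AddSubgroup.zmultiples (x i (F i)) := rfl
  refine ⟨fun i => x i (F i), fun i => (F i).1, monotone_nat_of_le_succ fun i => ?_, fun i => ?_,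
    fun i => hxV _ _, fun i => hxF _ _, fun i => hx _ _⟩
  · rw [hF]; exact le_sup_left
  · change x i (F i) ∈ (F i).1 ⊔ _
    exact le_sup_right (a := (F i).1) (AddSubgroup.mem_zmultiples _)

/-- The elements of an independent sequence with index `l i = m` are distinct modulo the subgroup
generated by `V (m + 1)` and the other elements: the last element occurring in a relation modulo
`V (m + 1)` can be removed from it by independence, until only elements preceding `g i` remain. -/
lemma notMem_sup_closure_of_independent {V : ℕ → AddSubgroup G} {g : ℕ → G}
    {F : ℕ → AddSubgroup G} {l : ℕ → ℕ} (hl : ∀ i, l i ≤ i) (hFm : Monotone F)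
    (hgF : ∀ i, g i ∈ F (i + 1)) (hgn : ∀ i, g i ∉ F i ⊔ V (l i + 1))
    (hg : ∀ i, ∀ m ≤ i, ∀ k : ℤ, k • g i ∈ F i ⊔ V (m + 1) → k • g i ∈ V (m + 1)) (i : ℕ) :
    g i ∉ F i ⊔ V (l i + 1) ⊔ AddSubgroup.closure (g '' {j | l j ≠ l i}) := by
  let C : ℕ → AddSubgroup G := fun k =>
    F i ⊔ V (l i + 1) ⊔ AddSubgroup.closure (g '' {j | j < k ∧ l j ≠ l i})
  have hCF (k : ℕ) (hk : i ≤ k) : C k ≤ F k ⊔ V (l i + 1) := by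
    refine sup_le (sup_le_sup_right (hFm hk) _) ((AddSubgroup.closure_le _).2 ?_)
    rintro _ ⟨j, ⟨hj, -⟩, rfl⟩
    exact le_sup_left (a := F k) (hFm (Nat.succ_le_of_lt hj) (hgF j))
  have hCmono : Monotone C := by
    intro a b hab
    refine sup_le_sup_left (AddSubgroup.closure_mono (Set.image_mono ?_)) _
    exact fun j hj => ⟨hj.1.trans_le hab, hj.2⟩
  have hC (k : ℕ) (hk : i + 1 ≤ k) : g i ∉ C k := by
    induction k, hk using Nat.le_induction with
    | base =>
      intro h
      refine hgn i (sup_le le_rfl ((AddSubgroup.closure_le _).2 ?_) h)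
      rintro _ ⟨j, ⟨hj, hlj⟩, rfl⟩
      have hji : j + 1 ≤ i := by
        rcases Nat.lt_succ_iff_lt_or_eq.1 hj with hj | rfl
        · exact hj
        · exact (hlj rfl).elim
      exact le_sup_left (a := F i) (hFm hji (hgF j))
    | succ k hk ih =>
      intro h
      have hle : C (k + 1) ≤ C k ⊔ AddSubgroup.zmultiples (g k) := by
        refine sup_le (le_sup_left.trans le_sup_left) ((AddSubgroup.closure_le _).2 ?_)
        rintro _ ⟨j, ⟨hj, hlj⟩, rfl⟩
        rcases Nat.lt_succ_iff_lt_or_eq.1 hj with hj | rfl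
        · exact le_sup_left (a := C k) (le_sup_right (a := F i ⊔ V (l i + 1))
            (AddSubgroup.subset_closure ⟨j, ⟨hj, hlj⟩, rfl⟩))
        · exact le_sup_right (a := C j) (AddSubgroup.mem_zmultiples _)
      obtain ⟨c, hc, z, hz, hcz⟩ := AddSubgroup.mem_sup.1 (hle h)
      obtain ⟨t, rfl⟩ := AddSubgroup.mem_zmultiples_iff.1 hz
      have hgk : g i ∈ F k ⊔ V (l i + 1) := le_sup_left (a := F k) (hFm hk (hgF i))
      have ht : t • g k ∈ F k ⊔ V (l i + 1) := by
        rw [← add_sub_cancel_left c (t • g k), hcz]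
        exact sub_mem hgk (hCF k (by omega) hc)
      have htV := hg k (l i) ((hl i).trans (by omega)) t ht
      refine ih ?_
      rw [← hcz]
      exact add_mem hc (le_sup_left (a := F i ⊔ V (l i + 1)) (le_sup_right (a := F i) htV))
  intro h
  have hle : F i ⊔ V (l i + 1) ⊔ AddSubgroup.closure (g '' {j | l j ≠ l i}) ≤ ⨆ k, C k := by
    refine sup_le (le_sup_left.trans (le_iSup C 0)) ((AddSubgroup.closure_le _).2 ?_)
    rintro _ ⟨j, hj, rfl⟩
    exact le_iSup C (j + 1) (le_sup_right (a := F i ⊔ V (l i + 1))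
      (AddSubgroup.subset_closure ⟨j, ⟨Nat.lt_succ_self j, hj⟩, rfl⟩))
  obtain ⟨k, hk⟩ := (AddSubgroup.mem_iSup_of_directed hCmono.directed_le).1 (hle h)
  exact hC (max k (i + 1)) (le_max_right _ _) (hCmono (le_max_left _ _) hk)

end Independence

namespace IsCompleteFiltration

variable {G : Type*} [AddCommGroup G] [TopologicalSpace G] [IsTopologicalAddGroup G]
  [SecondCountableTopology G] {V : ℕ → AddSubgroup G}

/-- If every `V n / V (n + 1)` has an infinite divisible quotient `V n / R`, the complements of
`V n / R` in `G / R` form a triangular system. -/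
lemma exists_prod_embedding_of_divisible (hV : IsCompleteFiltration V)
    (h : ∀ n, HasInfiniteDivisibleQuotient (V n) (V (n + 1))) :
    HasInfiniteProductInQuotient G := by
  choose R hWR hdiv hinf using h
  choose Q hRQ hQV hsup using fun n =>
    AddSubgroup.exists_complement_of_divisible (V n) (R n) (hdiv n)
  refine hV.exists_prod_embedding_quotient ⊤ isClosed_univ Q (fun m => (hWR m).trans (hRQ m)) ?_ ?_
  · intro m h _
    obtain ⟨q, hq, v, hv, rfl⟩ := AddSubgroup.mem_sup.1 (hsup m ▸ AddSubgroup.mem_top h)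
    exact ⟨v, ⟨AddSubgroup.mem_top v, hv⟩, by simpa using hq⟩
  · intro m
    refine AddSubgroup.relIndex_eq_zero_of_le_right (K := V m) le_top ?_
    rw [← AddSubgroup.inf_relIndex_right]
    exact AddSubgroup.relIndex_eq_zero_of_le_left (hQV m) (hinf m)

/-- If the infinite torsion groups `V n / V (n + 1)` have no infinite divisible quotient, an
independent sequence generates a dense subgroup of a suitable `H`. -/
lemma exists_prod_embedding_of_not_divisible (hV : IsCompleteFiltration V)
    (htor : ∀ n, ∀ g : G, ∃ k : ℕ, k ≠ 0 ∧ k • g ∈ V n)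
    (hinf : ∀ n, (V (n + 1)).relIndex (V n) = 0)
    (hdiv : ∀ n m, n < m → ¬ HasInfiniteDivisibleQuotient (V n) (V m)) :
    HasInfiniteProductInQuotient G := by
  -- Every index `m` is the value of `l` infinitely often, at the places `Nat.pair m b`.
  let l : ℕ → ℕ := fun i => (Nat.unpair i).1
  obtain ⟨g, F, hFm, hgF, hgV, hgn, hg⟩ := exists_independent_sequence hV.antitone htor hinf hdiv l
  let S : AddSubgroup G := AddSubgroup.closure (Set.range g)
  let Q : ℕ → AddSubgroup G := fun m => V (m + 1) ⊔ AddSubgroup.closure (g '' {j | l j ≠ m})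
  have hSH : S ≤ S.topologicalClosure := S.le_topologicalClosure
  refine hV.exists_prod_embedding_quotient S.topologicalClosure S.isClosed_topologicalClosure Q
    (fun m => le_sup_left) ?_ ?_
  · intro m h hh
    have hSle : S ≤ Q m ⊔ (S.topologicalClosure ⊓ V m) := by
      refine (AddSubgroup.closure_le _).2 ?_
      rintro _ ⟨j, rfl⟩
      by_cases hj : l j = m
      · exact le_sup_right (a := Q m)
          ⟨hSH (AddSubgroup.subset_closure ⟨j, rfl⟩), hj ▸ hgV j⟩
      · exact le_sup_left (a := Q m) (le_sup_right (a := V (m + 1))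
          (AddSubgroup.subset_closure ⟨j, hj, rfl⟩))
    have hopen : IsOpen ((Q m ⊔ (S.topologicalClosure ⊓ V m) : AddSubgroup G) : Set G) :=
      AddSubgroup.isOpen_mono (le_sup_left.trans le_sup_left) (hV.isOpen (m + 1))
    have hle : S.topologicalClosure ≤ Q m ⊔ (S.topologicalClosure ⊓ V m) :=
      S.topologicalClosure_minimal hSle (AddSubgroup.isClosed_of_isOpen _ hopen)
    obtain ⟨q, hq, v, hv, rfl⟩ := AddSubgroup.mem_sup.1 (hle hh)
    exact ⟨v, hv, by simpa using hq⟩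
  · intro m
    have hinj : Function.Injective (fun b : ℕ =>
        (QuotientAddGroup.mk (⟨g (Nat.pair m b),
          hSH (AddSubgroup.subset_closure ⟨_, rfl⟩)⟩ : S.topologicalClosure) :
          S.topologicalClosure ⧸ (Q m).addSubgroupOf S.topologicalClosure)) := by
      refine Function.Injective.of_lt_imp_ne fun a b hab h => ?_
      rw [QuotientAddGroup.eq, AddSubgroup.mem_addSubgroupOf] at h
      have hQ : -g (Nat.pair m a) + g (Nat.pair m b) ∈ Q m := h
      have hlb : l (Nat.pair m b) = m := by simp [l]
      refine notMem_sup_closure_of_independent (l := l) (fun i => Nat.unpair_left_le i) hFm hgF hgn hg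
        (Nat.pair m b) ?_
      rw [hlb, sup_assoc, ← add_neg_cancel_left (g (Nat.pair m a)) (g (Nat.pair m b))]
      exact AddSubgroup.add_mem_sup
        (hFm (Nat.succ_le_of_lt (Nat.pair_lt_pair_right m hab)) (hgF _)) hQ
    have := Infinite.of_injective _ hinj
    exact Nat.card_eq_zero_of_infinite

end IsCompleteFiltration

/-! ### The filtration of a quasi-torsion group -/

lemma exists_strictMono_forall_rel {P : ℕ → ℕ → Prop}
    (hmono : ∀ n m m', m ≤ m' → P n m → P n m') (h : ∀ a, ∃ n ≥ a, ∃ m, P n m) :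
    ∃ k : ℕ → ℕ, StrictMono k ∧ ∀ j, P (k j) (k (j + 1)) := by
  choose n hn m hm using h
  let x : ℕ → ℕ := fun j => Nat.rec 0 (fun _ x => max (m x) (n x + 1)) j
  have hx (j : ℕ) : x (j + 1) = max (m (x j)) (n (x j) + 1) := rfl
  refine ⟨fun j => n (x j), strictMono_nat_of_lt_succ fun j => ?_, fun j => ?_⟩
  · have h1 := hn (x (j + 1))
    have h2 := le_max_right (m (x j)) (n (x j) + 1)
    rw [← hx] at h2
    omega
  · refine hmono _ _ _ ?_ (hm (x j))
    exact (le_max_left _ _).trans ((hx j).symm.le.trans (hn (x (j + 1))))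

/-- A quasi-torsion group is filtered by the joint kernels of its first coordinate projections. If
all of them had finite index in the `n`-th one, the latter would be compact, being isomorphic to a
closed subgroup of a product of finite groups. -/
lemma IsQuasiTorsion.exists_filtration {G : Type*} [AddCommGroup G] [TopologicalSpace G]
    [IsTopologicalAddGroup G] (hG : IsQuasiTorsion G) (hlc : ¬ LocallyCompactSpace G) :
    ∃ V : ℕ → AddSubgroup G, IsCompleteFiltration V ∧
      (∀ n, ∀ g : G, ∃ k : ℕ, k ≠ 0 ∧ k • g ∈ V n) ∧
      ∀ n, ∃ m, (V m).relIndex (V n) = 0 := by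
  obtain ⟨A, _, _, φ, -, hdisc, htor, hφ, -⟩ := hG
  let p (k : ℕ) : G →+ A k := (Pi.evalAddMonoidHom A k).comp φ
  have hp (k : ℕ) (g : G) : p k g = φ g k := rfl
  have hpc (k : ℕ) : Continuous (p k) := (continuous_apply k).comp hφ.continuous
  have hpo (k : ℕ) : IsOpen ((p k).ker : Set G) := (isOpen_discrete {0}).preimage (hpc k)
  let V : ℕ → AddSubgroup G := fun n => ⨅ k : Fin (n + 1), (p k).ker
  have hmem (n : ℕ) (g : G) : g ∈ V n ↔ ∀ k ≤ n, p k g = 0 := by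
    simp only [V, AddSubgroup.mem_iInf, AddMonoidHom.mem_ker]
    exact ⟨fun h k hk => h ⟨k, by omega⟩, fun h k => h k (by omega)⟩
  have hVo (n : ℕ) : IsOpen (V n : Set G) := by
    simp only [V, AddSubgroup.coe_iInf]
    exact isOpen_iInter_of_finite fun k => hpo k
  refine ⟨V, ⟨?_, hVo, ?_, ?_⟩, ?_, ?_⟩
  · exact fun a b hab g hg => (hmem a g).2 fun k hk => (hmem b g).1 hg k (hk.trans hab)
  · intro U hU
    rw [hφ.isInducing.nhds_eq_comap, map_zero, mem_comap] at hU
    obtain ⟨U', hU', hUU'⟩ := hU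
    rw [nhds_pi, Filter.mem_pi] at hU'
    obtain ⟨I, hI, t, ht, htU⟩ := hU'
    obtain ⟨n, hn⟩ := hI.bddAbove
    refine ⟨n, fun g hg => hUU' (htU fun i hi => ?_)⟩
    rw [← hp, (hmem n g).1 hg i (hn hi)]
    exact mem_of_mem_nhds (ht i)
  · intro s hs
    have hev (k : ℕ) : ∃ M, ∀ m ≥ M, p k (s m) = p k (s M) := by
      have h1 : ∀ᶠ m in atTop, s (m + 1) - s m ∈ (p k).ker :=
        hs ((hpo k).mem_nhds (zero_mem _))
      obtain ⟨M, hM⟩ := eventually_atTop.1 h1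
      refine ⟨M, fun m hm => ?_⟩
      induction m, hm using Nat.le_induction with
      | base => rfl
      | succ m hm ih =>
        have h2 := hM m hm
        rw [AddMonoidHom.mem_ker, map_sub, sub_eq_zero] at h2
        rw [h2, ih]
    choose M hM using hev
    have hlim : Tendsto (fun m => φ (s m)) atTop (𝓝 fun k => p k (s (M k))) := by
      rw [tendsto_pi_nhds]
      exact fun k => tendsto_const_nhds.congr' <|
        (eventually_ge_atTop (M k)).mono fun m hm => (hM k m hm).symm
    obtain ⟨g, hg⟩ := hφ.isClosed_range.mem_of_tendsto hlim
      (Eventually.of_forall fun m => ⟨s m, rfl⟩)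
    exact ⟨g, hφ.isInducing.tendsto_nhds_iff.2 (hg ▸ hlim)⟩
  · intro n g
    refine ⟨∏ k ∈ Finset.range (n + 1), addOrderOf (p k g),
      Finset.prod_ne_zero_iff.2 fun k _ => (htor k (p k g)).addOrderOf_pos.ne', ?_⟩
    refine (hmem _ _).2 fun k hk => ?_
    rw [map_nsmul, ← addOrderOf_dvd_iff_nsmul_eq_zero]
    exact Finset.dvd_prod_of_mem (fun k => addOrderOf (p k g)) (Finset.mem_range.2 (by omega))
  · by_contra! h
    obtain ⟨n, hn⟩ := h
    have hfin (k : ℕ) : (p k '' (V n : Set G)).Finite := by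
      have h1 : (p k).ker.relIndex (V n) ≠ 0 := fun h0 =>
        hn k (AddSubgroup.relIndex_eq_zero_of_le_left (fun g hg => (hmem k g).1 hg k le_rfl) h0)
      rw [AddSubgroup.relIndex_ker] at h1
      have : Finite ((V n).map (p k)) := Nat.finite_of_card_ne_zero h1
      exact Set.toFinite ((V n).map (p k) : Set (A k))
    have hcomp : IsCompact (V n : Set G) := by
      rw [hφ.isInducing.isCompact_iff]
      refine (isCompact_univ_pi fun k => (hfin k).isCompact).of_isClosed_subset
        (hφ.isClosedMap _ ((V n).isClosed_of_isOpen (hVo n))) ?_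
      rintro _ ⟨g, hg, rfl⟩ k -
      exact ⟨g, hg, rfl⟩
    exact hlc (hcomp.locallyCompactSpace_of_mem_nhds_of_addGroup
      ((hVo n).mem_nhds (zero_mem (V n))))

theorem mainTheorem4 {G : Type*} [AddCommGroup G] [TopologicalSpace G] [IsTopologicalAddGroup G]
    [PolishSpace G] (hG : IsQuasiTorsion G) (hlc : ¬ LocallyCompactSpace G) :
    ∃ L : AddSubgroup G, IsClosed (L : Set G) ∧
      ∃ (K : ℕ → Type) (_ : ∀ n, AddCommGroup (K n)) (_ : ∀ n, TopologicalSpace (K n)),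
        (∀ n, Infinite (K n)) ∧ (∀ n, Countable (K n)) ∧ (∀ n, DiscreteTopology (K n)) ∧
        ∃ M : AddSubgroup (G ⧸ L), IsClosed (M : Set (G ⧸ L)) ∧
          Nonempty ((∀ n, K n) ≃ₜ+ M) := by
  obtain ⟨V, hV, htor, hinf⟩ := hG.exists_filtration hlc
  by_cases hD : ∀ a, ∃ n ≥ a, ∃ m, HasInfiniteDivisibleQuotient (V n) (V m)
  · obtain ⟨k, hk, hkD⟩ := exists_strictMono_forall_rel
      (fun n m m' hm h => h.mono (hV.antitone hm)) hD
    exact (hV.comp_strictMono hk).exists_prod_embedding_of_divisible hkD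
  · push Not at hD
    obtain ⟨a, ha⟩ := hD
    obtain ⟨k, hk, hkP⟩ := exists_strictMono_forall_rel
      (P := fun n m => a ≤ n ∧ (V m).relIndex (V n) = 0)
      (fun n m m' hm h =>
        ⟨h.1, AddSubgroup.relIndex_eq_zero_of_le_left (hV.antitone hm) h.2⟩)
      (fun b => ⟨max a b, le_max_right _ _,
        (hinf (max a b)).imp fun m hm => ⟨le_max_left _ _, hm⟩⟩)
    exact (hV.comp_strictMono hk).exists_prod_embedding_of_not_divisible
      (fun n g => htor (k n) g) (fun n => (hkP n).2) (fun n m _ => ha _ (hkP n).1 _)
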